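/- Let $R \subseteq S$ be an extension of commutative rings, where $R$ is regular (that is, $R$ is Noetherian and $R_{\mathfrak p}$ is a regular local ring for every prime ideal $\mathfrak p$ of $R$) and $S$ is finitely generated and projective as an $R$-module. Let $\mathfrak m$ be a maximal ideal of $S$ and put $\mathfrak n = \mathfrak m \cap R$. Let $\mathfrak n S = Q_1 \cap Q_2 \cap \cdots \cap Q_c$ be a minimal primary decomposition of the ideal $\mathfrak n S$ of $S$, where $Q_1$ is $\mathfrak m$-primary. Then $S/Q_1$ has finite length $\ell_R(S/Q_1)$ as an $R$-module, and there is an isomorphism of $R$-modules \[ E_S\left(S/\mathfrak m\right) \;\cong\; E_R\left(R/\mathfrak n\right)^{\ell_R(S/Q_1)}, \] where $E_A(M)$ denotes the injective hull of a module $M$ over a ring $A$. -/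

import Mathlib

universe u v w w₁ w₂

/-- `i : M → E` exhibits the `A`-module `E` as an injective hull `E_A(M)` of `M`: the map `i` is
injective, `E` is an injective `A`-module, and `E` is an essential extension of the image of `i`,
i.e. every submodule of `E` that meets the image of `i` trivially is zero.

`Module.Injective A E` tests against modules in the universe of `E`; as soon as that universe
contains (a copy of) `A`, this is injectivity in the usual sense. -/
structure IsInjectiveHull {A : Type u} [Ring A] {M : Type v} [AddCommGroup M] [Module A M]
    {E : Type w} [AddCommGroup E] [Module A E] (i : M →ₗ[A] E) : Prop where
  injective : Function.Injective i
  module_injective : Module.Injective A E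
  essential : ∀ N : Submodule A E, N ⊓ LinearMap.range i = ⊥ → N = ⊥

/-- Every module has an injective hull. -/
theorem exists_isInjectiveHull (A : Type u) [Ring A] (M : Type v) [AddCommGroup M] [Module A M] :
    ∃ (E : Type (max u v)) (_ : AddCommGroup E) (_ : Module A E) (i : M →ₗ[A] E),
      IsInjectiveHull i := by
  classical
  -- an injective module containing `M`
  obtain ⟨J, _, _, hJ, k, hk⟩ : ∃ (J : Type (max u v)) (_ : AddCommGroup J) (_ : Module A J)
      (_ : Module.Injective A J) (k : M →ₗ[A] J), Function.Injective k := by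
    let X : ModuleCat.{max u v} A := ModuleCat.of A (ULift.{u} M)
    obtain ⟨P⟩ := CategoryTheory.EnoughInjectives.presentation X
    have h1 : CategoryTheory.Injective (ModuleCat.of A P.J) := P.injective
    have h2 := Module.injective_module_of_injective_object A P.J
    refine ⟨P.J, inferInstance, inferInstance, h2,
      P.f.hom ∘ₗ (ULift.moduleEquiv (R := A) (M := M)).symm.toLinearMap, ?_⟩
    have := (ModuleCat.mono_iff_injective P.f).1 P.mono
    exact this.comp (LinearEquiv.injective _)
  let B : Submodule A J := LinearMap.range k
  -- a maximal essential extension of `M` inside `J`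
  obtain ⟨E, hBE, hE⟩ := zorn_le_nonempty₀
    {E : Submodule A J | ∀ x ∈ E, x ≠ 0 → ∃ r : A, r • x ∈ B ∧ r • x ≠ 0}
    (fun c hc hchain y hy => ⟨sSup c, by
      intro x hx hx0
      obtain ⟨z, hz, hxz⟩ := (Submodule.mem_sSup_of_directed ⟨y, hy⟩ hchain.directedOn).1 hx
      exact hc hz x hxz hx0, fun z hz => le_sSup hz⟩)
    B (fun x hx hx0 => ⟨1, by simpa using hx, by simpa using hx0⟩)
  -- a maximal complement of it
  obtain ⟨C, -, hC⟩ := zorn_le_nonempty₀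
    {C : Submodule A J | ∀ x ∈ C, x ∈ E → x = 0}
    (fun c hc hchain y hy => ⟨sSup c, by
      intro x hx hxE
      obtain ⟨z, hz, hxz⟩ := (Submodule.mem_sSup_of_directed ⟨y, hy⟩ hchain.directedOn).1 hx
      exact hc hz x hxz hxE, fun z hz => le_sSup hz⟩)
    ⊥ (fun x hx _ => by simpa using hx)
  have hCE : ∀ j, j ∉ C → ∃ (r : A), ∃ e ∈ E, e ≠ 0 ∧ C.mkQ e = r • C.mkQ j := by
    intro j hj
    by_contra! hcon
    have hmem : C ⊔ Submodule.span A {j} ∈ {C : Submodule A J | ∀ x ∈ C, x ∈ E → x = 0} := by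
      intro x hx hxE
      by_contra hx0
      obtain ⟨c, hc, y, hy, rfl⟩ := Submodule.mem_sup.1 hx
      obtain ⟨r, rfl⟩ := Submodule.mem_span_singleton.1 hy
      refine hcon r _ hxE hx0 ?_
      have h0 : C.mkQ c = 0 := by simpa using hc
      rw [map_add, h0, zero_add, map_smul]
    exact hj (hC.2 hmem le_sup_left (Submodule.mem_sup_right (Submodule.mem_span_singleton_self j)))
  obtain ⟨h, hh⟩ := Module.Injective.out (C.mkQ ∘ₗ E.subtype) (by
    rw [← LinearMap.ker_eq_bot, LinearMap.ker_eq_bot']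
    intro m hm
    have h0 : (m : J) ∈ C := by simpa using hm
    exact Subtype.ext (hC.1 _ h0 m.2)) E.subtype
  have hh' : ∀ e ∈ E, h (C.mkQ e) = e := fun e he => hh ⟨e, he⟩
  have hrange : LinearMap.range h ≤ E := by
    refine hE.2 ?_ ?_
    · rintro _ ⟨q, rfl⟩ hy
      obtain ⟨j, rfl⟩ := C.mkQ_surjective q
      have hj : j ∉ C := by
        intro hj
        have h0 : C.mkQ j = 0 := by simpa using hj
        exact hy (by rw [h0, map_zero])
      obtain ⟨r, e, heE, he0, her⟩ := hCE j hj
      obtain ⟨s, hs, hs0⟩ := hE.1 e heE he0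
      have : (s * r) • h (C.mkQ j) = s • e := by
        rw [mul_smul, ← map_smul h r, ← her, hh' e heE]
      exact ⟨s * r, this ▸ hs, this ▸ hs0⟩
    · intro e he
      exact ⟨_, hh' e he⟩
  let p : J →ₗ[A] E := (h ∘ₗ C.mkQ).codRestrict E (fun x => hrange ⟨_, rfl⟩)
  have hp : ∀ e : E, p e = e := fun e => Subtype.ext (hh' e e.2)
  refine ⟨E, inferInstance, inferInstance, k.codRestrict E (fun x => hBE ⟨x, rfl⟩), ?_, ?_, ?_⟩
  · intro x y hxy
    exact hk (congrArg Subtype.val hxy)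
  · refine ⟨fun X Y _ _ _ _ f hf g => ?_⟩
    obtain ⟨g', hg'⟩ := Module.Injective.out f hf (E.subtype ∘ₗ g)
    refine ⟨p ∘ₗ g', fun x => ?_⟩
    rw [LinearMap.comp_apply, hg']
    exact hp _
  · intro N hN
    rw [Submodule.eq_bot_iff]
    intro x hx
    by_contra hx0
    obtain ⟨r, ⟨m, hm⟩, hr0⟩ := hE.1 x.1 x.2 (fun h0 => hx0 (Subtype.ext h0))
    have : r • x ∈ N ⊓ LinearMap.range (k.codRestrict E (fun x => hBE ⟨x, rfl⟩)) :=
      ⟨N.smul_mem r hx, m, Subtype.ext hm⟩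
    rw [hN, Submodule.mem_bot] at this
    exact hr0 (congrArg Subtype.val this)

/-!
Two essential extensions of the same module which are both injective are isomorphic, so it suffices
to exhibit `E` and `F ^ l` as injective essential extensions of `(R / n) ^ l` over `R`. Flatness of
`S` makes `E` injective over `R`. Since `S` is Noetherian, every element of `E` is killed by a power
of `m`, hence by a power of `n`, so `E` is essential over its submodule `T` of elements killed by
`n`. The primes over `n S` are maximal, so the components `Q ≠ Q₁` are comaximal with `m` and have
no effect on the `m`-power torsion module `E`: thus `T` consists of the elements killed by `Q₁`,
that is `T = Hom_S(S / Q₁, E)`. The functor `Hom_S(-, E)` is exact and sends `S / m` to itself, so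
it preserves lengths of modules of finite length supported at `m`, and `T`, a vector space over
`R / n`, has dimension `l`.
-/

/-- `i : M → E` exhibits `E` as an essential extension of `M`: it is injective, and every nonzero
submodule of `E` meets its image nontrivially. An injective hull is an essential extension that is
an injective module; here the two requirements are separated, because essentiality is often
checked for modules that are not injective. -/
structure IsEssentialExtension {A : Type*} [Ring A] {M : Type*} [AddCommGroup M] [Module A M]
    {E : Type*} [AddCommGroup E] [Module A E] (i : M →ₗ[A] E) : Prop where
  injective : Function.Injective i
  essential : ∀ N : Submodule A E, N ⊓ LinearMap.range i = ⊥ → N = ⊥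

namespace IsEssentialExtension

variable {A : Type*} [Ring A] {M : Type*} [AddCommGroup M] [Module A M]
  {E : Type*} [AddCommGroup E] [Module A E] {i : M →ₗ[A] E}

theorem exists_smul_mem_range (hi : IsEssentialExtension i) {x : E} (hx : x ≠ 0) :
    ∃ a : A, a • x ≠ 0 ∧ a • x ∈ LinearMap.range i := by
  have hne : A ∙ x ⊓ LinearMap.range i ≠ ⊥ := fun h =>
    hx (Submodule.span_singleton_eq_bot.1 (hi.essential _ h))
  obtain ⟨y, ⟨hyx, hyi⟩, hy⟩ := (Submodule.ne_bot_iff _).1 hne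
  obtain ⟨a, rfl⟩ := Submodule.mem_span_singleton.1 hyx
  exact ⟨a, hy, hyi⟩

theorem of_exists_smul_mem_range (hi : Function.Injective i)
    (h : ∀ x : E, x ≠ 0 → ∃ a : A, a • x ≠ 0 ∧ a • x ∈ LinearMap.range i) :
    IsEssentialExtension i := by
  refine ⟨hi, fun N hN => (Submodule.eq_bot_iff N).2 fun x hxN => by_contra fun hx => ?_⟩
  obtain ⟨a, hax, hai⟩ := h x hx
  exact hax ((Submodule.eq_bot_iff _).1 hN _ ⟨N.smul_mem a hxN, hai⟩)

theorem comp_linearEquiv {M' : Type*} [AddCommGroup M'] [Module A M']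
    (hi : IsEssentialExtension i) (e : M' ≃ₗ[A] M) :
    IsEssentialExtension (i ∘ₗ e.toLinearMap) where
  injective := hi.injective.comp e.injective
  essential := by
    rw [LinearMap.range_comp_of_range_eq_top _ e.range]
    exact hi.essential

theorem piMap {ι : Type*} [Finite ι] {M E : ι → Type*} [∀ k, AddCommGroup (M k)]
    [∀ k, Module A (M k)] [∀ k, AddCommGroup (E k)] [∀ k, Module A (E k)]
    {i : ∀ k, M k →ₗ[A] E k} (hi : ∀ k, IsEssentialExtension (i k)) :
    IsEssentialExtension (LinearMap.piMap i) := by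
  classical
  cases nonempty_fintype ι
  refine of_exists_smul_mem_range (Function.Injective.piMap fun k => (hi k).injective)
    fun x hx => ?_
  suffices ∀ s : Finset ι, ∃ a : A, a • x ≠ 0 ∧ ∀ k ∈ s, a • x k ∈ LinearMap.range (i k) by
    obtain ⟨a, hax, ha⟩ := this Finset.univ
    choose y hy using fun k => ha k (Finset.mem_univ k)
    exact ⟨a, hax, y, funext hy⟩
  intro s
  induction s using Finset.induction_on with
  | empty => exact ⟨1, by rwa [one_smul], by simp⟩
  | insert k s _ ih =>
    obtain ⟨a, hax, ha⟩ := ih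
    by_cases hk : a • x k = 0
    · exact ⟨a, hax, (Finset.forall_mem_insert ..).2 ⟨hk ▸ zero_mem _, ha⟩⟩
    · obtain ⟨b, hb, hbk⟩ := (hi k).exists_smul_mem_range hk
      refine ⟨b * a, fun h => hb ?_, (Finset.forall_mem_insert ..).2 ⟨?_, fun l hl => ?_⟩⟩
      · rw [← mul_smul]
        exact congrFun h k
      · rwa [mul_smul]
      · rw [mul_smul]
        exact Submodule.smul_mem _ b (ha l hl)

theorem injective_of_comp {F : Type*} [AddCommGroup F] [Module A F]
    (hi : IsEssentialExtension i) {f : E →ₗ[A] F} (hf : Function.Injective (f ∘ₗ i)) :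
    Function.Injective f := by
  refine LinearMap.ker_eq_bot.1 (hi.essential _ ((Submodule.eq_bot_iff _).2 ?_))
  rintro _ ⟨hx, y, rfl⟩
  rw [(map_eq_zero_iff (f ∘ₗ i) hf).1 hx, map_zero]

theorem nonempty_linearEquiv {F : Type*} [AddCommGroup F] [Module A F] {j : M →ₗ[A] F}
    (hi : IsEssentialExtension i) (hj : IsEssentialExtension j)
    (hE : Module.Baer A E) (hF : Module.Baer A F) : Nonempty (E ≃ₗ[A] F) := by
  obtain ⟨f, hf⟩ := hF.extension_property i hi.injective j
  have hf_inj : Function.Injective f := hi.injective_of_comp (hf ▸ hj.injective)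
  obtain ⟨g, hg⟩ := hE.extension_property f hf_inj LinearMap.id
  have hgj : g ∘ₗ j = i := by rw [← hf, ← LinearMap.comp_assoc, hg, LinearMap.id_comp]
  have hg_inj : Function.Injective g := hj.injective_of_comp (hgj ▸ hi.injective)
  have hgf : ∀ x, g (f x) = x := LinearMap.congr_fun hg
  exact ⟨LinearEquiv.ofBijective f ⟨hf_inj, fun y => ⟨g y, hg_inj (hgf (g y))⟩⟩⟩

end IsEssentialExtension

theorem IsInjectiveHull.isEssentialExtension {A : Type*} [Ring A] {M : Type*} [AddCommGroup M]
    [Module A M] {E : Type*} [AddCommGroup E] [Module A E] {i : M →ₗ[A] E}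
    (hE : IsInjectiveHull i) : IsEssentialExtension i :=
  ⟨hE.injective, hE.essential⟩

section Baer

theorem baer_pi {A : Type*} [Ring A] {ι : Type*} {F : ι → Type*} [∀ k, AddCommGroup (F k)]
    [∀ k, Module A (F k)] (hF : ∀ k, Module.Baer A (F k)) : Module.Baer A (∀ k, F k) := by
  intro I g
  choose h hh using fun k => hF k I (LinearMap.proj k ∘ₗ g)
  exact ⟨LinearMap.pi h, fun x hx => funext fun k => hh k x hx⟩

-- Maps from an ideal `I` of `R` to `E` extend to `S ⊗ I`, which flatness embeds in `S ⊗ R`.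
theorem baer_restrictScalars_of_flat {R S : Type*} [CommRing R] [CommRing S] [Algebra R S]
    [Module.Flat R S] {E : Type*} [AddCommGroup E] [Module S E] [Module R E] [IsScalarTower R S E]
    (hE : Module.Baer S E) : Module.Baer R E := by
  intro I g
  obtain ⟨h, hh⟩ := hE.extension_property (I.subtype.baseChange S)
    (Module.Flat.lTensor_preserves_injective_linearMap _ I.subtype_injective) (g.liftBaseChange S)
  refine ⟨h.restrictScalars R ∘ₗ TensorProduct.mk R S R 1, fun x hx => ?_⟩
  simpa using LinearMap.congr_fun hh (1 ⊗ₜ[R] ⟨x, hx⟩)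

end Baer

section PrimaryComponent

variable {A : Type*} [CommRing A] {I : Ideal A} {M : Type*} [AddCommGroup M] [Module A M]

theorem mem_primaryComponent_iff {x : M} :
    x ∈ I.primaryComponent M ↔ ∃ k : ℕ, ∀ a ∈ I ^ k, a • x = 0 := by
  simp only [Ideal.primaryComponent_mem, Submodule.mem_torsionBySet_iff, Subtype.forall,
    SetLike.mem_coe]

theorem primaryComponent_eq_top_iff :
    I.primaryComponent M = ⊤ ↔ ∀ x : M, ∃ k : ℕ, ∀ a ∈ I ^ k, a • x = 0 := by
  simp only [Submodule.eq_top_iff', mem_primaryComponent_iff]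

theorem primaryComponent_eq_top_of_le_annihilator (hM : I ≤ Module.annihilator A M) :
    I.primaryComponent M = ⊤ :=
  primaryComponent_eq_top_iff.2 fun x =>
    ⟨1, fun _ ha => Module.mem_annihilator.1 (hM (pow_one I ▸ ha)) x⟩

theorem mem_primaryComponent_iff_le_radical_colon (hI : I.FG) {x : M} :
    x ∈ I.primaryComponent M ↔ I ≤ ((⊥ : Submodule A M).colon {x}).radical := by
  have hpow (k : ℕ) : (∀ a ∈ I ^ k, a • x = 0) ↔ I ^ k ≤ (⊥ : Submodule A M).colon {x} := by
    simp only [SetLike.le_def, Submodule.mem_colon_singleton, Submodule.mem_bot]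
  simp only [mem_primaryComponent_iff, hpow]
  exact ⟨fun ⟨k, hk⟩ _ ha => ⟨k, hk (Ideal.pow_mem_pow ha k)⟩,
    fun h => Ideal.exists_pow_le_of_le_radical_of_fg h hI⟩

theorem exists_smul_mem_torsionBySet_of_mem_primaryComponent {x : M} (hx : x ≠ 0)
    (hxI : x ∈ I.primaryComponent M) :
    ∃ a : A, a • x ≠ 0 ∧ a • x ∈ Submodule.torsionBySet A M I := by
  obtain ⟨k, hk⟩ := mem_primaryComponent_iff.1 hxI
  induction k with
  | zero => exact absurd (by simpa using hk 1 (by simp)) hx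
  | succ k ih =>
    by_cases h : ∀ a ∈ I ^ k, a • x = 0
    · exact ih h
    push Not at h
    obtain ⟨a, ha, hax⟩ := h
    refine ⟨a, hax, (Submodule.mem_torsionBySet_iff _ _).2 fun b => ?_⟩
    rw [← mul_smul]
    exact hk _ (pow_succ' I k ▸ Ideal.mul_mem_mul b.2 ha)

theorem isEssentialExtension_subtype_torsionBySet (hM : I.primaryComponent M = ⊤) :
    IsEssentialExtension (Submodule.torsionBySet A M I).subtype := by
  refine .of_exists_smul_mem_range (Submodule.subtype_injective _) fun x hx => ?_
  rw [Submodule.range_subtype]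
  exact exists_smul_mem_torsionBySet_of_mem_primaryComponent hx (hM ▸ Submodule.mem_top)

theorem torsionBySet_inf_of_sup_eq_top {J Q : Ideal A} (hM : I.primaryComponent M = ⊤)
    (hIJ : I ⊔ J = ⊤) :
    Submodule.torsionBySet A M ↑(Q ⊓ J) = Submodule.torsionBySet A M (Q : Set A) := by
  refine le_antisymm (fun x hx => (Submodule.mem_torsionBySet_iff _ _).2 fun ⟨q, hq⟩ => ?_)
    (Submodule.torsionBySet_le_torsionBySet_of_subset inf_le_left)
  rw [Submodule.mem_torsionBySet_iff] at hx
  obtain ⟨k, hk⟩ := primaryComponent_eq_top_iff.1 hM x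
  obtain ⟨a, ha, b, hb, hab⟩ := Submodule.mem_sup.1
    ((Ideal.eq_top_iff_one _).1 (Ideal.pow_sup_eq_top (n := k) hIJ))
  have hax : a • x = 0 := hk a ha
  have hbx : (q * b) • x = 0 := hx ⟨q * b, Q.mul_mem_right b hq, J.mul_mem_left q hb⟩
  calc q • x = q • (a + b) • x := by rw [hab, one_smul]
    _ = q • a • x + (q * b) • x := by rw [add_smul, smul_add, mul_smul]
    _ = 0 := by rw [hax, hbx, smul_zero, add_zero]

theorem torsionBySet_eq_restrictScalars_map {S : Type*} [CommRing S] [Algebra A S] [Module S M]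
    [IsScalarTower A S M] :
    Submodule.torsionBySet A M (I : Set A) =
      (Submodule.torsionBySet S M ↑(I.map (algebraMap A S))).restrictScalars A := by
  rw [Ideal.map, ← Submodule.torsionBySet_eq_torsionBySet_span]
  ext x
  simp

theorem primaryComponent_under_eq_top {S : Type*} [CommRing S] [Algebra A S] [Module S M]
    [IsScalarTower A S M] {J : Ideal S} (hM : J.primaryComponent M = ⊤) :
    (J.under A).primaryComponent M = ⊤ := by
  refine primaryComponent_eq_top_iff.2 fun x => ?_
  obtain ⟨k, hk⟩ := primaryComponent_eq_top_iff.1 hM x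
  refine ⟨k, fun a ha => ?_⟩
  rw [← algebraMap_smul S]
  exact hk _ (Ideal.le_comap_pow _ k ha)

namespace IsEssentialExtension

variable {E : Type*} [AddCommGroup E] [Module A E] {i : M →ₗ[A] E}

-- Over a Noetherian ring a minimal prime over the annihilator of `x` is itself the annihilator of
-- a multiple `y` of `x`, and `y` has a nonzero multiple in `M`.
theorem primaryComponent_eq_top [IsNoetherianRing A] (hi : IsEssentialExtension i)
    (hM : I.primaryComponent M = ⊤) : I.primaryComponent E = ⊤ := by
  refine eq_top_iff.2 fun x _ =>
    (mem_primaryComponent_iff_le_radical_colon (IsNoetherian.noetherian I)).2 ?_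
  rw [← Ideal.sInf_minimalPrimes]
  refine le_sInf fun p hp => ?_
  obtain ⟨y, rfl⟩ := Submodule.exists_eq_colon_of_mem_minimalPrimes hp
  have hprime := Ideal.IsMinimalPrime.isPrime hp
  have hy : y ≠ 0 := by
    rintro rfl
    exact hprime.ne_top ((Ideal.eq_top_iff_one _).2 (by simp))
  obtain ⟨a, hay, z, hz⟩ := hi.exists_smul_mem_range hy
  obtain ⟨k, hk⟩ := primaryComponent_eq_top_iff.1 hM z
  refine hprime.le_of_pow_le (n := k) fun b hb => ?_
  have hbz : b • z = 0 := hk b hb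
  have hba : b * a ∈ (⊥ : Submodule A E).colon {y} := by
    rw [Submodule.mem_colon_singleton, Submodule.mem_bot, mul_smul, ← hz, ← map_smul, hbz,
      map_zero]
  refine (hprime.mem_or_mem hba).resolve_right fun ha => hay ?_
  rwa [Submodule.mem_colon_singleton, Submodule.mem_bot] at ha

theorem torsionBySet_le_range [hI : I.IsMaximal] (hi : IsEssentialExtension i) :
    Submodule.torsionBySet A E I ≤ LinearMap.range i := by
  intro y hy
  by_cases hy0 : y = 0
  · exact hy0 ▸ zero_mem _
  obtain ⟨a, hay, hai⟩ := hi.exists_smul_mem_range hy0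
  rw [Submodule.mem_torsionBySet_iff] at hy
  have ha : a ∉ I := fun h => hay (hy ⟨a, h⟩)
  obtain ⟨b, c, hc, hbc⟩ := hI.exists_inv ha
  have hcy : c • y = 0 := hy ⟨c, hc⟩
  have hby : b • a • y = y := by
    calc b • a • y = (b * a + c) • y := by rw [add_smul, mul_smul, hcy, add_zero]
      _ = y := by rw [hbc, one_smul]
  exact hby ▸ Submodule.smul_mem _ b hai

end IsEssentialExtension

end PrimaryComponent

section ResidueField

variable {A : Type*} [CommRing A] {I : Ideal A} {M : Type*} [AddCommGroup M] [Module A M]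

theorem isSemisimpleModule_of_le_annihilator [I.IsMaximal] (hM : I ≤ Module.annihilator A M) :
    IsSemisimpleModule A M := by
  have hMI : Module.IsTorsionBySet A M (I : Set A) :=
    (Module.isTorsionBySet_iff_subset_annihilator ..).2 hM
  let : Module (A ⧸ I) M := hMI.module
  let : Field (A ⧸ I) := Ideal.Quotient.field I
  exact hMI.isSemisimpleModule_iff.1 inferInstance

theorem isFiniteLength_of_le_annihilator [I.IsMaximal] [Module.Finite A M]
    (hM : I ≤ Module.annihilator A M) : IsFiniteLength A M := by
  have := isSemisimpleModule_of_le_annihilator hM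
  exact (IsSemisimpleModule.finite_tfae.out 0 3).1 ‹_›

theorem nonempty_linearEquiv_quotient_of_isSimpleModule [hI : I.IsMaximal]
    [hM : IsSimpleModule A M] {k : ℕ} (hk : I ^ k ≤ Module.annihilator A M) :
    Nonempty (M ≃ₗ[A] A ⧸ I) := by
  obtain ⟨P, hP, ⟨e⟩⟩ := isSimpleModule_iff_quot_maximal.1 hM
  rw [e.annihilator_eq, Ideal.annihilator_quotient] at hk
  obtain rfl := hI.eq_of_le hP.ne_top (hP.isPrime.le_of_pow_le hk)
  exact ⟨e⟩

theorem nonempty_linearEquiv_pi_of_length_eq [hI : I.IsMaximal]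
    (hM : I ≤ Module.annihilator A M) {l : ℕ} (hl : Module.length A M = l) :
    Nonempty (M ≃ₗ[A] (Fin l → A ⧸ I)) := by
  have := isSemisimpleModule_of_le_annihilator hM
  have hfin : IsFiniteLength A M := Module.length_ne_top_iff.1 (hl ▸ ENat.natCast_ne_top l)
  have : Module.Finite A M := (IsSemisimpleModule.finite_tfae.out 0 3).2 hfin
  have hisotypic : IsIsotypicOfType A M (A ⧸ I) := fun N _ =>
    nonempty_linearEquiv_quotient_of_isSimpleModule (k := 1) <| by
      rw [pow_one]
      exact hM.trans (N.subtype.annihilator_le_of_injective N.subtype_injective)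
  obtain ⟨k, ⟨e⟩⟩ := hisotypic.linearEquiv_fun
  have : IsSimpleModule A (A ⧸ I) := isSimpleModule_iff_quot_maximal.2 ⟨I, hI, ⟨.refl _ _⟩⟩
  rw [e.length_eq, Module.length_pi, Module.length_eq_one, mul_one, ENat.card_eq_coe_fintype_card,
    Fintype.card_fin, Nat.cast_inj] at hl
  exact hl ▸ ⟨e⟩

end ResidueField

section MatlisDuality

/-- Linear maps `A ⧸ I → M` correspond to elements of `M` killed by `I`, through the image of `1`;
this identifies the dual of a cyclic module with a torsion submodule. -/
def homQuotientEquivTorsionBySet {A : Type*} [CommRing A] (I : Ideal A) (M : Type*)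
    [AddCommGroup M] [Module A M] :
    ((A ⧸ I) →ₗ[A] M) ≃ₗ[A] Submodule.torsionBySet A M (I : Set A) where
  toFun f := ⟨f 1, (Submodule.mem_torsionBySet_iff _ _).2 fun a => by
    rw [← map_smul, Module.mem_annihilator.1 (I.annihilator_quotient.ge a.2), map_zero]⟩
  map_add' _ _ := rfl
  map_smul' _ _ := rfl
  invFun x := I.liftQ (LinearMap.toSpanSingleton A M (x : M)) fun a ha =>
    (Submodule.mem_torsionBySet_iff _ _).1 x.2 ⟨a, ha⟩
  left_inv f := Submodule.linearMap_qext _ (LinearMap.ext_ring (one_smul A (f 1)))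
  right_inv x := Subtype.ext (one_smul A (x : M))

variable {S : Type*} [CommRing S] {E : Type*} [AddCommGroup E] [Module S E]

theorem IsEssentialExtension.nonempty_linearEquiv_hom {m : Ideal S} [m.IsMaximal]
    {i : (S ⧸ m) →ₗ[S] E} (hi : IsEssentialExtension i) :
    Nonempty (((S ⧸ m) →ₗ[S] E) ≃ₗ[S] S ⧸ m) := by
  have hrange : LinearMap.range i = Submodule.torsionBySet S E (m : Set S) := by
    refine le_antisymm ?_ hi.torsionBySet_le_range
    rintro _ ⟨z, rfl⟩
    refine (Submodule.mem_torsionBySet_iff _ _).2 fun a => ?_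
    rw [← map_smul, Module.mem_annihilator.1 (m.annihilator_quotient.ge a.2), map_zero]
  exact ⟨homQuotientEquivTorsionBySet m E ≪≫ₗ LinearEquiv.ofEq _ _ hrange.symm ≪≫ₗ
    (LinearEquiv.ofInjective i hi.injective).symm⟩

variable {R : Type*} [CommRing R] [Algebra R S] [Module R E] [IsScalarTower R S E]

theorem length_hom_eq_quotient_add_submodule {M : Type*} [AddCommGroup M] [Module S M] [Module R M]
    [IsScalarTower R S M] (hE : Module.Baer S E) (N : Submodule S M) :
    Module.length R (M →ₗ[S] E) =
      Module.length R ((M ⧸ N) →ₗ[S] E) + Module.length R (N →ₗ[S] E) := by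
  refine Module.length_eq_add_of_exact (N.mkQ.lcomp R E) (N.subtype.lcomp R E)
    (LinearMap.lcomp_injective_of_surjective _ N.mkQ_surjective)
    (fun g => hE.extension_property _ N.subtype_injective g) ?_
  exact LinearMap.exact_lcomp_of_exact_of_surjective E (LinearMap.exact_subtype_mkQ N)
    N.mkQ_surjective

theorem length_eq_submodule_add_quotient {M : Type*} [AddCommGroup M] [Module S M] [Module R M]
    [IsScalarTower R S M] (N : Submodule S M) :
    Module.length R M = Module.length R N + Module.length R (M ⧸ N) :=
  Module.length_eq_add_of_exact (N.subtype.restrictScalars R) (N.mkQ.restrictScalars R)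
    N.subtype_injective N.mkQ_surjective (LinearMap.exact_subtype_mkQ N)

theorem IsEssentialExtension.length_hom_eq {m : Ideal S} [m.IsMaximal] {i : (S ⧸ m) →ₗ[S] E}
    (hi : IsEssentialExtension i) (hE : Module.Baer S E) {M : Type*} [AddCommGroup M]
    [Module S M] [instR : Module R M] [IsScalarTower R S M] (hM : IsFiniteLength S M) {k : ℕ}
    (hk : m ^ k ≤ Module.annihilator S M) :
    Module.length R (M →ₗ[S] E) = Module.length R M := by
  induction hM generalizing instR with
  | of_subsingleton => rw [Module.length_eq_zero, Module.length_eq_zero]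
  | @of_simple_quotient M _ _ N _ _ ih =>
    have hkN := hk.trans (N.subtype.annihilator_le_of_injective N.subtype_injective)
    have hkQ := hk.trans (N.mkQ.annihilator_le_of_surjective N.mkQ_surjective)
    obtain ⟨e⟩ := nonempty_linearEquiv_quotient_of_isSimpleModule hkQ
    obtain ⟨d⟩ := hi.nonempty_linearEquiv_hom
    have hquot : Module.length R ((M ⧸ N) →ₗ[S] E) = Module.length R (M ⧸ N) :=
      calc Module.length R ((M ⧸ N) →ₗ[S] E)
        _ = Module.length R ((S ⧸ m) →ₗ[S] E) := (LinearEquiv.congrLeft E R e).length_eq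
        _ = Module.length R (S ⧸ m) := (d.restrictScalars R).length_eq
        _ = Module.length R (M ⧸ N) := (e.restrictScalars R).length_eq.symm
    rw [length_hom_eq_quotient_add_submodule hE N, hquot, ih hkN,
      length_eq_submodule_add_quotient N, add_comm]

end MatlisDuality

section PrimaryDecomposition

theorem sup_inf_erase_eq_top {S : Type*} [CommRing S] [DecidableEq (Ideal S)] {I : Ideal S}
    (hI : ∀ P : Ideal S, P.IsPrime → I ≤ P → P.IsMaximal) {t : Finset (Ideal S)}
    (ht : Submodule.IsMinimalPrimaryDecomposition I t) {Q : Ideal S} (hQ : Q ∈ t) :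
    Q ⊔ (t.erase Q).inf id = ⊤ := by
  have hmax {J : Ideal S} (hJ : J ∈ t) : J.radical.IsMaximal :=
    hI _ (Ideal.isPrime_radical (ht.primary hJ))
      ((ht.inf_eq.ge.trans (Finset.inf_le hJ)).trans Ideal.le_radical)
  rw [Finset.inf_eq_iInf]
  refine Ideal.sup_iInf_eq_top fun J hJ => ?_
  obtain ⟨hne, hJt⟩ := Finset.mem_erase.1 hJ
  have hradical : Q.radical ≠ J.radical := by
    have := ht.distinct hQ hJt hne.symm
    simpa only [Function.onFun, Submodule.colon_univ] using this
  rw [id, ← Ideal.radical_eq_top, Ideal.radical_sup, (hmax hQ).coprime_of_ne (hmax hJt) hradical,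
    Ideal.radical_top]

variable {R S : Type*} [CommRing R] [CommRing S] [Algebra R S]

theorem isMaximal_of_map_le [Algebra.IsIntegral R S] {n : Ideal R} [hn : n.IsMaximal]
    {P : Ideal S} [hP : P.IsPrime] (hnP : n.map (algebraMap R S) ≤ P) : P.IsMaximal := by
  have hcomap : n = P.comap (algebraMap R S) :=
    hn.eq_of_le (hP.under R).ne_top (Ideal.map_le_iff_le_comap.1 hnP)
  exact Ideal.isMaximal_of_isIntegral_of_isMaximal_comap P (hcomap ▸ hn)

theorem isFiniteLength_quotient_of_map_le [Module.Finite R S] {n : Ideal R}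
    [n.IsMaximal] {Q : Ideal S} (hQ : n.map (algebraMap R S) ≤ Q) : IsFiniteLength R (S ⧸ Q) := by
  refine isFiniteLength_of_le_annihilator (I := n) ?_
  rw [← Module.comap_annihilator (R := S), Ideal.annihilator_quotient]
  exact Ideal.map_le_iff_le_comap.1 hQ

theorem torsionBySet_under_eq_of_isMinimalPrimaryDecomposition
    [Algebra.IsIntegral R S] {m : Ideal S} [m.IsMaximal]
    {t : Finset (Ideal S)}
    (ht : Submodule.IsMinimalPrimaryDecomposition ((m.under R).map (algebraMap R S)) t)
    {Q : Ideal S} (hQ : Q ∈ t) (hQm : Q.radical = m)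
    {E : Type*} [AddCommGroup E] [Module S E] [Module R E] [IsScalarTower R S E]
    (hE : m.primaryComponent E = ⊤) :
    Submodule.torsionBySet R E (m.under R : Set R) =
      (Submodule.torsionBySet S E (Q : Set S)).restrictScalars R := by
  classical
  have hmJ : m ⊔ (t.erase Q).inf id = ⊤ := top_le_iff.1 <|
    (sup_inf_erase_eq_top (fun P _ => isMaximal_of_map_le) ht hQ).ge.trans
      (sup_le_sup_right (Ideal.le_radical.trans hQm.le) _)
  rw [torsionBySet_eq_restrictScalars_map (S := S), ← ht.inf_eq, ← Finset.insert_erase hQ,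
    Finset.inf_insert, id, torsionBySet_inf_of_sup_eq_top hE hmJ]

end PrimaryDecomposition

section Decomposition

variable {R S : Type*} [CommRing R] [CommRing S] [Algebra R S]

theorem nonempty_linearEquiv_pi_of_length_torsionBySet_eq {n : Ideal R} [n.IsMaximal]
    {E F : Type*} [AddCommGroup E] [Module R E] [AddCommGroup F] [Module R F]
    (hE : Module.Baer R E) (hF : Module.Baer R F) (hEn : n.primaryComponent E = ⊤)
    {j : (R ⧸ n) →ₗ[R] F} (hj : IsEssentialExtension j) {l : ℕ}
    (hl : Module.length R (Submodule.torsionBySet R E (n : Set R)) = l) :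
    Nonempty (E ≃ₗ[R] (Fin l → F)) := by
  have hn : n ≤ Module.annihilator R (Submodule.torsionBySet R E (n : Set R)) :=
    (Module.isTorsionBySet_iff_subset_annihilator ..).1
      (Submodule.torsionBySet_isTorsionBySet (n : Set R))
  obtain ⟨e⟩ := nonempty_linearEquiv_pi_of_length_eq hn hl
  exact (isEssentialExtension_subtype_torsionBySet hEn).nonempty_linearEquiv
    ((IsEssentialExtension.piMap fun _ => hj).comp_linearEquiv e) hE (baer_pi fun _ => hF)

theorem length_torsionBySet_under_eq [IsNoetherianRing S] [Module.Finite R S] {m : Ideal S}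
    [m.IsMaximal] {t : Finset (Ideal S)}
    (ht : Submodule.IsMinimalPrimaryDecomposition ((m.under R).map (algebraMap R S)) t)
    {Q : Ideal S} (hQ : Q ∈ t) (hQm : Q.radical = m)
    {E : Type*} [AddCommGroup E] [Module S E] [Module R E] [IsScalarTower R S E]
    (hE : Module.Baer S E) {i : (S ⧸ m) →ₗ[S] E} (hi : IsEssentialExtension i) :
    Module.length R (Submodule.torsionBySet R E (m.under R : Set R)) =
      Module.length R (S ⧸ Q) := by
  have hEm : m.primaryComponent E = ⊤ := hi.primaryComponent_eq_top
    (primaryComponent_eq_top_of_le_annihilator m.annihilator_quotient.ge)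
  obtain ⟨k, hk⟩ := Ideal.exists_pow_le_of_le_radical_of_fg hQm.ge (IsNoetherian.noetherian m)
  have hfin : IsFiniteLength R (S ⧸ Q) :=
    isFiniteLength_quotient_of_map_le (ht.inf_eq.ge.trans (Finset.inf_le hQ))
  obtain ⟨_, _⟩ := isFiniteLength_iff_isNoetherian_isArtinian.1 hfin
  have hfinS : IsFiniteLength S (S ⧸ Q) :=
    isFiniteLength_iff_isNoetherian_isArtinian.2 ⟨inferInstance, isArtinian_of_tower R ‹_›⟩
  let e := homQuotientEquivTorsionBySet Q E
  calc Module.length R (Submodule.torsionBySet R E (m.under R : Set R))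
    _ = Module.length R ((Submodule.torsionBySet S E (Q : Set S)).restrictScalars R) := by
      rw [torsionBySet_under_eq_of_isMinimalPrimaryDecomposition ht hQ hQm hEm]
    _ = Module.length R (Submodule.torsionBySet S E (Q : Set S)) := rfl
    _ = Module.length R ((S ⧸ Q) →ₗ[S] E) := (e.restrictScalars R).length_eq.symm
    _ = Module.length R (S ⧸ Q) :=
      hi.length_hom_eq hE hfinS (hk.trans Q.annihilator_quotient.ge)

end Decomposition

theorem theorem4_general {R : Type u} {S : Type v} [CommRing R] [CommRing S] [Algebra R S]
    [IsNoetherianRing S] [Module.Finite R S] [Module.Flat R S]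
    (m : Ideal S) [m.IsMaximal]
    (t : Finset (Ideal S))
    (ht : Submodule.IsMinimalPrimaryDecomposition ((m.under R).map (algebraMap R S)) t)
    (Q₁ : Ideal S) (hQ₁ : Q₁ ∈ t) (hQ₁m : Q₁.radical = m)
    {E : Type w₁} [Small.{w₁} S] [AddCommGroup E] [Module S E] [Module R E] [IsScalarTower R S E]
    (i : (S ⧸ m) →ₗ[S] E) (hE : IsInjectiveHull i)
    {F : Type w₂} [Small.{w₂} R] [AddCommGroup F] [Module R F]
    (j : (R ⧸ m.under R) →ₗ[R] F) (hF : IsInjectiveHull j) :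
    ∃ l : ℕ, Module.length R (S ⧸ Q₁) = l ∧ Nonempty (E ≃ₗ[R] (Fin l → F)) := by
  have hES : Module.Baer S E := .of_injective hE.module_injective
  have hFR : Module.Baer R F := .of_injective hF.module_injective
  have hEm : m.primaryComponent E = ⊤ := hE.isEssentialExtension.primaryComponent_eq_top
    (primaryComponent_eq_top_of_le_annihilator m.annihilator_quotient.ge)
  have hfin : IsFiniteLength R (S ⧸ Q₁) :=
    isFiniteLength_quotient_of_map_le (ht.inf_eq.ge.trans (Finset.inf_le hQ₁))
  obtain ⟨l, hl⟩ := ENat.ne_top_iff_exists.1 (Module.length_ne_top_iff.2 hfin)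
  have hlength : Module.length R (Submodule.torsionBySet R E (m.under R : Set R)) = l :=
    (length_torsionBySet_under_eq ht hQ₁ hQ₁m hES hE.isEssentialExtension).trans hl.symm
  exact ⟨l, hl.symm, nonempty_linearEquiv_pi_of_length_torsionBySet_eq
    (baer_restrictScalars_of_flat hES) hFR (primaryComponent_under_eq_top hEm)
    hF.isEssentialExtension hlength⟩

theorem theorem4 {R : Type u} {S : Type v} [CommRing R] [CommRing S] [Algebra R S]
    (hRS : Function.Injective (algebraMap R S)) [IsRegularRing R]
    [Module.Finite R S] [Module.Projective R S]
    (m : Ideal S) [m.IsMaximal]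
    (t : Finset (Ideal S))
    (ht : Submodule.IsMinimalPrimaryDecomposition ((m.under R).map (algebraMap R S)) t)
    (Q₁ : Ideal S) (hQ₁ : Q₁ ∈ t) (hQ₁m : Q₁.radical = m)
    {E : Type (max v w₁)} [AddCommGroup E] [Module S E] [Module R E] [IsScalarTower R S E]
    (i : (S ⧸ m) →ₗ[S] E) (hE : IsInjectiveHull i)
    {F : Type (max u w₂)} [AddCommGroup F] [Module R F]
    (j : (R ⧸ m.under R) →ₗ[R] F) (hF : IsInjectiveHull j) :
    ∃ l : ℕ, Module.length R (S ⧸ Q₁) = l ∧ Nonempty (E ≃ₗ[R] (Fin l → F)) :=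
  have := IsNoetherianRing.of_finite R S
  theorem4_general m t ht Q₁ hQ₁ hQ₁m i hE j hF
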